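/- An ideal on $\mathbb N$ is a family $\mathcal I$ of subsets of $\mathbb N$ that is closed under finite unions and under taking subsets, contains all singletons, and does not contain $\mathbb N$. Identifying subsets of a set $S$ with their characteristic functions, a family of subsets of $S$ has the Baire property if, as a subset of $\{0,1\}^S$ with the product topology, it differs from an open set by a meager set. The ideal $\mathcal I$ has the hereditary Baire property if for every $X\subseteq\mathbb N$ with $X\notin\mathcal I$ the family $\mathcal I\upharpoonright X=\{A\cap X:A\in\mathcal I\}$ has the Baire property as a subset of $\{0,1\}^X$. Let $\ell_\infty$ be the Banach space of bounded real sequences with the supremum norm. A real number $t$ is an $\mathcal I$-cluster point of $x\in\ell_\infty$ if $\{n\in\mathbb N:|x(n)-t|<\varepsilon\}\notin\mathcal I$ for every $\varepsilon>0$. For a cardinal $\kappa$, let $\operatorname{L}_{\mathcal I}(\kappa)$ be the set of all $x\in\ell_\infty$ that have exactly $\kappa$ many $\mathcal I$-cluster points. The density of a topological space is the least cardinality of a dense subset. Write $\omega$ for the countably infinite cardinal and $\mathfrak c$ for the cardinality of the continuum. **Theorem.** Let $\mathcal I$ be an ideal on $\mathbb N$. (i) If $\mathcal I$ has the Baire property,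 then there is a closed linear subspace $V$ of $\ell_\infty$ of density $\mathfrak c$ with $V\subseteq\operatorname{L}_{\mathcal I}(\omega)\cup\{0\}$. (ii) If $\mathcal I$ has the hereditary Baire property, then there is a closed linear subspace $V$ of $\ell_\infty$ of density $\mathfrak c$ with $V\subseteq\operatorname{L}_{\mathcal I}(\mathfrak c)\cup\{0\}$. -/

import Mathlib

open scoped ENNReal

/-- The space of bounded real sequences with the supremum norm. -/
abbrev BddSeq : Type := lp (fun _ : ℕ => ℝ) ∞

/-- An ideal on `ℕ`: a family of subsets of `ℕ` closed under finite unions and subsets, which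
does not contain `ℕ` and contains all singletons. -/
structure IsIdealOnNat (I : Set (Set ℕ)) : Prop where
  union_mem : ∀ A ∈ I, ∀ B ∈ I, A ∪ B ∈ I
  subset_mem : ∀ A ∈ I, ∀ B ⊆ A, B ∈ I
  univ_notMem : Set.univ ∉ I
  singleton_mem : ∀ n : ℕ, {n} ∈ I

/-- A family `F` of subsets of `S` viewed, through characteristic functions, as a subset of
`{0,1}^S`. -/
def toCantor {S : Type*} (F : Set (Set S)) : Set (S → Bool) :=
  {f | {s | f s = true} ∈ F}

/-- A family of subsets of `S` has the Baire property if the corresponding subset of `{0,1}^S`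
(product of discrete topologies) does, i.e. it differs from a Borel (equivalently, from an open)
set by a meager set. -/
def HasBaireProperty {S : Type*} (F : Set (Set S)) : Prop :=
  BaireMeasurableSet (toCantor F)

/-- The restriction `{A ∩ X : A ∈ I}`, as a family of subsets of the type `X`. -/
def restrictIdeal (I : Set (Set ℕ)) (X : Set ℕ) : Set (Set X) :=
  {B | ∃ A ∈ I, B = Subtype.val ⁻¹' A}

/-- `I` has the hereditary Baire property: its restriction to every `X ∉ I` has the Baire property
in `{0,1}^X`. -/
def HasHereditaryBaireProperty (I : Set (Set ℕ)) : Prop :=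
  ∀ X : Set ℕ, X ∉ I → HasBaireProperty (restrictIdeal I X)

/-- The set of `I`-cluster points of a bounded sequence. -/
def clusterPts (I : Set (Set ℕ)) (x : BddSeq) : Set ℝ :=
  {t | ∀ ε : ℝ, 0 < ε → {n : ℕ | |x n - t| < ε} ∉ I}

/-- The set of bounded sequences with exactly `κ` many `I`-cluster points. -/
def clusterCardSet (I : Set (Set ℕ)) (κ : Cardinal.{0}) : Set BddSeq :=
  {x | Cardinal.mk (clusterPts I x) = κ}

/-- The density of a topological space: the least cardinality of a dense subset. -/
noncomputable def densityCard (X : Type*) [TopologicalSpace X] : Cardinal :=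
  sInf {κ | ∃ D : Set X, Dense D ∧ Cardinal.mk D = κ}

/-- `M` contains, up to the zero element, a closed linear subspace of density continuum. -/
def ContainsClosedSubspaceOfDensityContinuum (M : Set BddSeq) : Prop :=
  ∃ V : Submodule ℝ BddSeq,
    IsClosed (V : Set BddSeq) ∧ (V : Set BddSeq) ⊆ M ∪ {0} ∧ densityCard V = Cardinal.continuum

/-!
The proof rests on a partition of `ℕ` into infinitely many sets outside the ideal `I`. An ideal with
the Baire property is meager in `{0,1}^ℕ` (`IsIdealOnNat.isMeagre_toCantor`), and a generic
`f : ℕ → ℕ` pulls every singleton back to a set avoiding a given meager family, so all fibers of `f`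
are outside `I` (`IsIdealOnNat.exists_forall_fiber_notMem`). A sequence constant on each fiber of
such an `f` has as its `I`-cluster points exactly the closure of its set of values
(`clusterPts_eq_closure_range`), and the ideal plays no further role.

Label the fibers by `P × K`, with `P` and `K` countable, and fix `z : K → ℝ` with `|z| ≤ 1` and with
value `1` somewhere. Sending `x ∈ ℓ∞(P)` to the sequence with value `x p * z k` on the fiber labelled
`(p, k)` is a linear isometry, so it maps a closed subspace `W` to a closed subspace of the same
density (`containsClosedSubspace_of_card_closure_range`). It remains to choose `W` and `z`, where `P`
is the set of nodes of the binary tree.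

* For `𝔠` cluster points, take `W = ℓ∞(P)` and `z` dense in `[0, 1]`: if `x p ≠ 0`, the closure of
  the values contains the segment from `0` to `x p`.
* For `ω` cluster points, take `z k = 1 / (k + 1)`, so that the values are infinitely many as soon as
  `x ≠ 0`, and let `W` be the closed span of the indicators of the branches of the tree. The branches
  are almost disjoint, and an element of `W` is a uniform limit of finite combinations of their
  indicators. All of these live on countably many branches, and along each branch they have a limit.
  Hence an element of `W` has only countably many accumulation points
  (`countable_closure_range_of_mem_branchSpace`).

In both cases `W` contains the indicators of the `𝔠` many branches, which are at distance at least
`1` from each other, so that its density is `𝔠`.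
-/

open Filter Topology

/-! ### Ideals with the Baire property -/

/-- Suppose the ideal is comeager in an open set. That set contains a cylinder, and flipping all
coordinates outside the finite support of the cylinder preserves it, so some member of the ideal
has a flipped set that is again a member; their union is cofinite, which is absurd. -/
theorem IsIdealOnNat.isMeagre_toCantor {I : Set (Set ℕ)} (hI : IsIdealOnNat I)
    (hB : HasBaireProperty I) : IsMeagre (toCantor I) := by
  obtain ⟨U, hU, hIU⟩ := BaireMeasurableSet.residualEq_isOpen hB
  rcases U.eq_empty_or_nonempty with rfl | ⟨x₀, hx₀⟩
  · rw [eventuallyEq_set] at hIU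
    filter_upwards [hIU] with x hx using fun h => (hx.1 h).elim
  exfalso
  obtain ⟨F, u, hu, hFU⟩ := isOpen_pi_iff.1 hU x₀ hx₀
  -- `σ` flips the coordinates outside `F`; it maps the cylinder `F.pi u` to itself.
  let σ : (ℕ → Bool) → ℕ → Bool := Pi.map fun n b => if n ∈ F then b else !b
  have hσ : Tendsto σ (residual _) (residual _) := by
    refine tendsto_residual_of_isOpenMap (.piMap fun n => continuous_of_discreteTopology)
      (.piMap (fun n => fun s _ => isOpen_discrete _) (.of_forall fun n b => ?_))
    by_cases hn : n ∈ F
    · exact ⟨b, by simp [hn]⟩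
    · exact ⟨!b, by simp [hn]⟩
  rw [eventuallyEq_set] at hIU
  have hdense := dense_of_mem_residual (hIU.and (hσ.eventually hIU))
  obtain ⟨x, hxC, hx, hσx⟩ := hdense.inter_open_nonempty ((F : Set ℕ).pi u)
    (isOpen_set_pi F.finite_toSet fun a ha => (hu a ha).1) ⟨x₀, fun a ha => (hu a ha).2⟩
  have hσC : σ x ∈ (F : Set ℕ).pi u := fun a ha => by
    simpa [σ, Pi.map, Finset.mem_coe.1 ha] using hxC a ha
  have h₁ : {n | x n = true} ∈ I := hx.2 (hFU hxC)
  have h₂ : {n | σ x n = true} ∈ I := hσx.2 (hFU hσC)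
  have hfin : ∀ G : Finset ℕ, (G : Set ℕ) ∈ I := by
    intro G
    induction G using Finset.induction_on with
    | empty => simpa using hI.subset_mem _ (hI.singleton_mem 0) ∅ (Set.empty_subset _)
    | insert a G _ ih =>
      rw [Finset.coe_insert, Set.insert_eq]
      exact hI.union_mem _ (hI.singleton_mem a) _ ih
  refine hI.univ_notMem (hI.subset_mem _
    (hI.union_mem _ (hI.union_mem _ h₁ _ h₂) _ (hfin F)) _ fun n _ => ?_)
  by_cases hn : n ∈ F
  · exact Or.inr hn
  · cases hxn : x n
    · exact Or.inl (Or.inr (by simp [σ, hn, hxn]))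
    · exact Or.inl (Or.inl hxn)

/-- For each `k` the map sending `f : ℕ → ℕ` to its fiber over `k` is continuous and open, so the
fibers of a generic `f` avoid the meager ideal. -/
theorem IsIdealOnNat.exists_forall_fiber_notMem {I : Set (Set ℕ)} (hI : IsIdealOnNat I)
    (hB : HasBaireProperty I) : ∃ f : ℕ → ℕ, ∀ k, f ⁻¹' {k} ∉ I := by
  have key : ∀ k : ℕ, ∀ᶠ f : ℕ → ℕ in residual _, f ⁻¹' {k} ∉ I := by
    intro k
    let Φ : (ℕ → ℕ) → ℕ → Bool := Pi.map fun _ m => decide (m = k)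
    have hΦ : Tendsto Φ (residual _) (residual _) := by
      refine tendsto_residual_of_isOpenMap (.piMap fun n => continuous_of_discreteTopology)
        (.piMap (fun n => fun s _ => isOpen_discrete _) (.of_forall fun n b => ?_))
      cases b
      · exact ⟨k + 1, by simp⟩
      · exact ⟨k, by simp⟩
    filter_upwards [hΦ (hI.isMeagre_toCantor hB)] with f hf hfI
    refine hf ?_
    have : {n | Φ f n = true} = f ⁻¹' {k} := by ext n; simp [Φ]
    change {n | Φ f n = true} ∈ I
    rwa [this]
  exact (dense_of_mem_residual (eventually_countable_forall.2 key)).nonempty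

theorem HasHereditaryBaireProperty.hasBaireProperty {I : Set (Set ℕ)} (hI : IsIdealOnNat I)
    (h : HasHereditaryBaireProperty I) : HasBaireProperty I := by
  let e : (ℕ → Bool) ≃ₜ (↥(Set.univ : Set ℕ) → Bool) :=
    (Homeomorph.piCongrLeft (Y := fun _ => Bool) (Equiv.Set.univ ℕ)).symm
  have := (h _ hI.univ_notMem).preimage e.continuous e.isOpenMap
  have he : e ⁻¹' toCantor (restrictIdeal I Set.univ) = toCantor I := by
    ext x
    constructor
    · rintro ⟨A, hA, hxA⟩
      have : {n | x n = true} = A := by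
        ext n
        exact Set.ext_iff.1 hxA ⟨n, trivial⟩
      change {n | x n = true} ∈ I
      rwa [this]
    · intro hx
      exact ⟨_, hx, rfl⟩
  rwa [he] at this

/-! ### Sequences constant on the pieces of a partition -/

/-- The isometric embedding `x ↦ (x (a m) * w m)ₘ` of `ℓ∞(P)` into `ℓ∞`, for weights `w` bounded
by `1` which attain the value `1` over each point of `P`. -/
noncomputable def weightedPullback {P : Type*} (a : ℕ → P) (w : ℕ → ℝ) (hw : ∀ m, |w m| ≤ 1)
    (ha : ∀ p, ∃ m, a m = p ∧ w m = 1) : lp (fun _ : P => ℝ) ∞ →ₗᵢ[ℝ] BddSeq :=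
  have hle (x : lp (fun _ : P => ℝ) ∞) (m : ℕ) : ‖x (a m) * w m‖ ≤ ‖x‖ := by
    rw [norm_mul]
    exact (mul_le_of_le_one_right (norm_nonneg _) (hw m)).trans
      (lp.norm_apply_le_norm ENNReal.top_ne_zero x _)
  { toFun := fun x => ⟨fun m => x (a m) * w m,
      memℓp_infty ⟨‖x‖, Set.forall_mem_range.2 (hle x)⟩⟩
    map_add' := fun x y => lp.ext (funext fun m => add_mul (x (a m)) (y (a m)) (w m))
    map_smul' := fun c x => lp.ext (funext fun m => mul_assoc c (x (a m)) (w m))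
    norm_map' := fun x => by
      refine le_antisymm (lp.norm_le_of_forall_le (norm_nonneg _) (hle x))
        (lp.norm_le_of_forall_le (norm_nonneg _) fun p => ?_)
      obtain ⟨m, rfl, hm⟩ := ha p
      refine le_trans (le_of_eq ?_) (lp.norm_apply_le_norm ENNReal.top_ne_zero _ m)
      simp [hm] }

theorem clusterPts_eq_closure_range {I : Set (Set ℕ)} (hI : IsIdealOnNat I) {f : ℕ → ℕ}
    (hf : ∀ k, f ⁻¹' {k} ∉ I) {S : Type*} {e : ℕ → S} (he : Function.Surjective e) (u : S → ℝ)
    {y : BddSeq} (hy : ∀ n, y n = u (e (f n))) : clusterPts I y = closure (Set.range u) := by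
  ext t
  rw [Metric.mem_closure_range_iff]
  refine forall₂_congr fun ε hε => ⟨fun h => ?_, ?_⟩
  · have hne : {n : ℕ | |y n - t| < ε}.Nonempty := by
      by_contra hempty
      rw [Set.not_nonempty_iff_eq_empty] at hempty
      rw [hempty] at h
      exact h (hI.subset_mem _ (hI.singleton_mem 0) ∅ (Set.empty_subset _))
    obtain ⟨n, hn⟩ := hne
    refine ⟨e (f n), ?_⟩
    rw [dist_comm, Real.dist_eq, ← hy]
    exact hn
  · rintro ⟨s, hs⟩ hmem
    obtain ⟨k, rfl⟩ := he s
    refine hf k (hI.subset_mem _ hmem _ fun n hn => ?_)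
    rw [Set.mem_preimage, Set.mem_singleton_iff] at hn
    rw [dist_comm, Real.dist_eq] at hs
    simpa [hy, hn] using hs

theorem continuum_le_densityCard {X : Type} [MetricSpace X] (g : (ℕ → Bool) → X)
    (hg : Pairwise fun α β => 1 ≤ dist (g α) (g β)) : Cardinal.continuum ≤ densityCard X := by
  refine le_csInf ⟨_, Set.univ, dense_univ, rfl⟩ ?_
  rintro _ ⟨D, hD, rfl⟩
  have hex : ∀ α, ∃ d : D, dist (g α) d < 1 / 2 := fun α =>
    let ⟨d, hd, h⟩ := hD.exists_dist_lt (g α) one_half_pos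
    ⟨⟨d, hd⟩, h⟩
  -- Points at distance at least `1` have different approximations within `1 / 2`.
  choose d hd using hex
  have hinj : Function.Injective d := by
    intro α β hαβ
    by_contra hne
    have h₁ := hg hne
    have h₂ := hd α
    have h₃ := hd β
    rw [← hαβ, dist_comm] at h₃
    linarith [dist_triangle (g α) (d α) (g β)]
  simpa using Cardinal.mk_le_of_injective hinj

theorem densityCard_le_continuum (V : Submodule ℝ BddSeq) :
    densityCard V ≤ Cardinal.continuum := by
  have h : densityCard V ≤ Cardinal.mk (Set.univ : Set V) := csInf_le' ⟨Set.univ, dense_univ, rfl⟩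
  refine h.trans ?_
  rw [Cardinal.mk_univ]
  have hinj : Function.Injective fun x : V => (fun n => (x : BddSeq) n : ℕ → ℝ) :=
    fun x y h => Subtype.ext (lp.ext h)
  simpa [Cardinal.mk_real] using Cardinal.mk_le_of_injective hinj

/-- Split `ℕ` into infinitely many sets outside `I`, label the pieces by `P × K`, and send
`x ∈ ℓ∞(P)` to the sequence which is constantly `x p * z k` on the piece labelled `(p, k)`. Its
cluster points are the closure of the set of its values. -/
theorem containsClosedSubspace_of_card_closure_range {I : Set (Set ℕ)} (hI : IsIdealOnNat I)
    {f : ℕ → ℕ} (hf : ∀ k, f ⁻¹' {k} ∉ I) {P K : Type} [Countable P] [Nonempty P] [Countable K]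
    (z : K → ℝ) (hz : ∀ k, |z k| ≤ 1) (k₀ : K) (hk₀ : z k₀ = 1)
    (W : Submodule ℝ (lp (fun _ : P => ℝ) ∞)) (hW : IsClosed (W : Set (lp (fun _ : P => ℝ) ∞)))
    (g : (ℕ → Bool) → lp (fun _ : P => ℝ) ∞) (hgW : ∀ α, g α ∈ W)
    (hg : Pairwise fun α β => 1 ≤ dist (g α) (g β)) (c : Cardinal.{0})
    (hc : ∀ x ∈ W, x ≠ 0 →
      Cardinal.mk (closure (Set.range fun q : P × K => x q.1 * z q.2)) = c) :
    ContainsClosedSubspaceOfDensityContinuum (clusterCardSet I c) := by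
  have : Nonempty K := ⟨k₀⟩
  obtain ⟨e, he⟩ := exists_surjective_nat (P × K)
  have hfs : Function.Surjective f := fun k => by
    by_contra hk
    refine hf k ?_
    have : f ⁻¹' {k} = ∅ := Set.eq_empty_of_forall_notMem fun n hn => hk ⟨n, hn⟩
    rw [this]
    exact hI.subset_mem _ (hI.singleton_mem 0) ∅ (Set.empty_subset _)
  have ha : ∀ p, ∃ m, (e (f m)).1 = p ∧ z (e (f m)).2 = 1 := fun p => by
    obtain ⟨m, hm⟩ := (he.comp hfs) (p, k₀)
    rw [Function.comp_apply] at hm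
    exact ⟨m, by rw [hm], by rw [hm, hk₀]⟩
  let T := weightedPullback (fun m => (e (f m)).1) (fun m => z (e (f m)).2) (fun m => hz _) ha
  refine ⟨W.map T.toLinearMap, ?_, ?_, ?_⟩
  · rw [Submodule.map_coe]
    exact T.isometry.isClosedEmbedding.isClosedMap _ hW
  · rintro _ ⟨x, hx, rfl⟩
    rcases eq_or_ne x 0 with rfl | hx0
    · exact Or.inr (map_zero T)
    · refine Or.inl ?_
      change Cardinal.mk (clusterPts I (T x)) = c
      rw [clusterPts_eq_closure_range hI hf he (fun q : P × K => x q.1 * z q.2) fun n => rfl]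
      exact hc x hx hx0
  · refine le_antisymm (densityCard_le_continuum _)
      (continuum_le_densityCard (fun α => ⟨T (g α), Submodule.mem_map_of_mem (hgW α)⟩)
        fun α β hαβ => ?_)
    change 1 ≤ dist (T (g α)) (T (g β))
    rw [T.isometry.dist_eq]
    exact hg hαβ

/-! ### The closed span of the branches of the binary tree -/

/-- The branch of `α` in the binary tree: the set of nodes `⟨n, s⟩` such that `s` is the
restriction of `α` to its first `n` values. -/
def branch (α : ℕ → Bool) : Set (Σ n : ℕ, Fin n → Bool) :=
  {p | p.2 = fun i : Fin p.1 => α i}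

theorem finite_branch_inter_branch {α β : ℕ → Bool} (h : α ≠ β) :
    (branch α ∩ branch β).Finite := by
  obtain ⟨i, hi⟩ := Function.ne_iff.1 h
  refine ((Set.finite_Iic i).image fun n => (⟨n, fun j => α j⟩ : Σ n : ℕ, Fin n → Bool)).subset ?_
  rintro ⟨n, s⟩ ⟨hs, hs'⟩
  change s = (fun j : Fin n => α j) at hs
  change s = (fun j : Fin n => β j) at hs'
  refine ⟨n, Set.mem_Iic.2 (not_lt.1 fun hin => hi ?_), by rw [hs]⟩
  exact congrFun (hs.symm.trans hs') ⟨i, hin⟩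

open Classical in
/-- The indicator function of a branch, as an element of `ℓ∞` of the binary tree. -/
noncomputable def branchIndicator (α : ℕ → Bool) :
    lp (fun _ : Σ n : ℕ, Fin n → Bool => ℝ) ∞ :=
  ⟨(branch α).indicator 1, memℓp_infty ⟨1, Set.forall_mem_range.2 fun p => by
    by_cases hp : p ∈ branch α <;> simp [hp]⟩⟩

theorem branchIndicator_apply (α : ℕ → Bool) (p : Σ n : ℕ, Fin n → Bool) :
    branchIndicator α p = (branch α).indicator 1 p := rfl

theorem pairwise_one_le_dist_branchIndicator :
    Pairwise fun α β => 1 ≤ dist (branchIndicator α) (branchIndicator β) := by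
  intro α β h
  obtain ⟨i, hi⟩ := Function.ne_iff.1 h
  rw [dist_eq_norm]
  let p : Σ n : ℕ, Fin n → Bool := ⟨i + 1, fun j => α j⟩
  have hα : p ∈ branch α := rfl
  have hβ : p ∉ branch β := fun h => hi (congrFun h (Fin.last i))
  refine le_trans (le_of_eq ?_) (lp.norm_apply_le_norm ENNReal.top_ne_zero _ p)
  simp [branchIndicator_apply, hα, hβ]

/-- The closed linear span of the indicators of the branches. -/
noncomputable def branchSpace : Submodule ℝ (lp (fun _ : Σ n : ℕ, Fin n → Bool => ℝ) ∞) :=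
  (Submodule.span ℝ (Set.range branchIndicator)).topologicalClosure

theorem exists_finset_support_subset_of_mem_span {y : lp (fun _ : Σ n : ℕ, Fin n → Bool => ℝ) ∞}
    (hy : y ∈ Submodule.span ℝ (Set.range branchIndicator)) :
    ∃ F : Finset (ℕ → Bool), ∀ p, y p ≠ 0 → p ∈ ⋃ α ∈ F, branch α := by
  classical
  induction hy using Submodule.span_induction with
  | mem y hy =>
    obtain ⟨α, rfl⟩ := hy
    refine ⟨{α}, fun p hp => ?_⟩
    simpa [branchIndicator_apply] using hp
  | zero => exact ⟨∅, fun p hp => (hp rfl).elim⟩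
  | add x y _ _ hx hy =>
    obtain ⟨F, hF⟩ := hx
    obtain ⟨G, hG⟩ := hy
    refine ⟨F ∪ G, fun p hp => ?_⟩
    rw [Finset.set_biUnion_union]
    by_cases hxp : x p = 0
    · exact Or.inr (hG p fun hyp => hp (by simp [hxp, hyp]))
    · exact Or.inl (hF p hxp)
  | smul c x _ hx =>
    obtain ⟨F, hF⟩ := hx
    exact ⟨F, fun p hp => hF p fun h => hp (by simp [h])⟩


theorem exists_eventually_eq_of_mem_span {y : lp (fun _ : Σ n : ℕ, Fin n → Bool => ℝ) ∞}
    (hy : y ∈ Submodule.span ℝ (Set.range branchIndicator)) (α : ℕ → Bool) :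
    ∃ c, ∀ᶠ p in cofinite ⊓ 𝓟 (branch α), y p = c := by
  induction hy using Submodule.span_induction with
  | mem y hy =>
    obtain ⟨β, rfl⟩ := hy
    rcases eq_or_ne α β with rfl | hne
    · refine ⟨1, eventually_inf_principal.2 (.of_forall fun p hp => ?_)⟩
      simp [branchIndicator_apply, hp]
    · refine ⟨0, eventually_inf_principal.2 ?_⟩
      filter_upwards [(finite_branch_inter_branch hne).compl_mem_cofinite] with p hp hpα
      have : p ∉ branch β := fun hpβ => hp ⟨hpα, hpβ⟩
      simp [branchIndicator_apply, this]
  | zero => exact ⟨0, .of_forall fun p => rfl⟩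
  | add x y _ _ hx hy =>
    obtain ⟨c, hc⟩ := hx
    obtain ⟨d, hd⟩ := hy
    refine ⟨c + d, ?_⟩
    filter_upwards [hc, hd] with p hp hp'
    simp [hp, hp']
  | smul r x _ hx =>
    obtain ⟨c, hc⟩ := hx
    refine ⟨r * c, ?_⟩
    filter_upwards [hc] with p hp
    simp [hp]

theorem exists_span_dist_lt_of_mem_branchSpace
    {x : lp (fun _ : Σ n : ℕ, Fin n → Bool => ℝ) ∞} (hx : x ∈ branchSpace) {ε : ℝ} (hε : 0 < ε) :
    ∃ y ∈ Submodule.span ℝ (Set.range branchIndicator), ∀ p, |x p - y p| < ε := by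
  obtain ⟨y, hy, hxy⟩ := Metric.mem_closure_iff.1 hx ε hε
  refine ⟨y, hy, fun p => ?_⟩
  rw [dist_eq_norm] at hxy
  exact (lp.norm_apply_le_norm ENNReal.top_ne_zero (x - y) p).trans_lt hxy

/-- An element of `branchSpace` has at most one accumulation point along each branch, since it is
a uniform limit of functions which are eventually constant along that branch. -/
theorem subsingleton_mapClusterPt_branch
    {x : lp (fun _ : Σ n : ℕ, Fin n → Bool => ℝ) ∞} (hx : x ∈ branchSpace) (α : ℕ → Bool) :
    {t : ℝ | MapClusterPt t (cofinite ⊓ 𝓟 (branch α)) x}.Subsingleton := by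
  intro t ht t' ht'
  refine eq_of_forall_dist_le fun ε hε => ?_
  obtain ⟨y, hy, hxy⟩ := exists_span_dist_lt_of_mem_branchSpace hx (show 0 < ε / 4 by positivity)
  obtain ⟨c, hc⟩ := exists_eventually_eq_of_mem_span hy α
  have key : ∀ s : ℝ, MapClusterPt s (cofinite ⊓ 𝓟 (branch α)) x → |s - c| < ε / 2 := by
    intro s hs
    obtain ⟨p, hp, hpc⟩ := ((mapClusterPt_iff_frequently.1 hs _
      (Metric.ball_mem_nhds s (show 0 < ε / 4 by positivity))).and_eventually hc).exists
    rw [Metric.mem_ball, Real.dist_eq] at hp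
    have h := hxy p
    rw [hpc] at h
    rw [abs_lt] at *
    constructor <;> linarith
  have h₁ := abs_lt.1 (key t ht)
  have h₂ := abs_lt.1 (key t' ht')
  rw [Real.dist_eq, abs_le]
  constructor <;> linarith

theorem mem_range_or_mapClusterPt_of_mem_closure_range {S : Type*} {u : S → ℝ} {t : ℝ}
    (ht : t ∈ closure (Set.range u)) : t ∈ Set.range u ∨ MapClusterPt t cofinite u := by
  refine or_iff_not_imp_right.2 fun h => ?_
  simp only [mapClusterPt_iff_frequently, not_forall, not_frequently] at h
  obtain ⟨s, hs, hfin⟩ := h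
  have hfin' : {p | u p ∈ s}.Finite := by simpa using hfin
  have hcl : t ∈ closure (Set.range u ∩ s) := by
    rw [mem_closure_iff_nhds] at ht ⊢
    intro v hv
    rw [Set.inter_comm (Set.range u), ← Set.inter_assoc]
    exact ht _ (inter_mem hv hs)
  have hsub : (Set.range u ∩ s).Finite := by
    refine (hfin'.image u).subset ?_
    rintro _ ⟨⟨p, rfl⟩, hp⟩
    exact ⟨p, hp, rfl⟩
  rw [hsub.isClosed.closure_eq] at hcl
  exact hcl.1

/-- The elements of the span approximating `x` live on countably many branches, and every nonzero
accumulation point of `x` is its accumulation point along one of these. -/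
theorem countable_closure_range_of_mem_branchSpace
    {x : lp (fun _ : Σ n : ℕ, Fin n → Bool => ℝ) ∞} (hx : x ∈ branchSpace) :
    (closure (Set.range x)).Countable := by
  choose y hy hxy using fun n : ℕ =>
    exists_span_dist_lt_of_mem_branchSpace hx (Nat.one_div_pos_of_nat (α := ℝ) (n := n))
  choose F hF using fun n => exists_finset_support_subset_of_mem_span (hy n)
  have hcount : (Set.range x ∪ {0} ∪ ⋃ n, ⋃ α ∈ F n,
      {t : ℝ | MapClusterPt t (cofinite ⊓ 𝓟 (branch α)) x}).Countable := by
    refine ((Set.countable_range _).union (Set.countable_singleton 0)).union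
      (Set.countable_iUnion fun n => (F n).countable_toSet.biUnion fun α _ => ?_)
    exact (subsingleton_mapClusterPt_branch hx α).countable
  refine hcount.mono fun t ht => ?_
  rcases mem_range_or_mapClusterPt_of_mem_closure_range ht with ht | ht
  · exact Or.inl (Or.inl ht)
  rcases eq_or_ne t 0 with rfl | ht0
  · exact Or.inl (Or.inr rfl)
  refine Or.inr ?_
  obtain ⟨n, hn⟩ := exists_nat_one_div_lt (half_pos (abs_pos.2 ht0))
  -- Near `t` the sequence `x` exceeds its distance to `y n`, so `y n` does not vanish there.
  obtain ⟨U, hU, hUt⟩ := mapClusterPt_iff_ultrafilter.1 ht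
  have hmem : (⋃ α ∈ F n, branch α) ∈ U := by
    filter_upwards [hUt (Metric.ball_mem_nhds t (half_pos (abs_pos.2 ht0)))] with p hp
    refine hF n p fun hyp => ?_
    have h₁ := hxy n p
    rw [hyp, sub_zero] at h₁
    rw [Set.mem_preimage, Metric.mem_ball, Real.dist_eq, abs_sub_comm] at hp
    linarith [abs_sub_abs_le_abs_sub t (x p)]
  obtain ⟨α, hα, hαU⟩ := (Ultrafilter.finite_biUnion_mem_iff (F n).finite_toSet).1 hmem
  refine Set.mem_iUnion.2 ⟨n, Set.mem_iUnion₂.2 ⟨α, hα, ?_⟩⟩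
  exact mapClusterPt_iff_ultrafilter.2 ⟨U, le_inf hU (le_principal_iff.2 hαU), hUt⟩

/-! ### Cardinality of the set of cluster points -/

theorem mk_closure_range_mul_one_div {S : Type} {u : S → ℝ}
    (hb : Bornology.IsBounded (Set.range u)) (hc : (closure (Set.range u)).Countable)
    {s : S} (hs : u s ≠ 0) :
    Cardinal.mk (closure (Set.range fun q : S × ℕ => u q.1 * (1 / ((q.2 : ℝ) + 1)))) =
      Cardinal.aleph0 := by
  let z : ℕ → ℝ := fun k => 1 / ((k : ℝ) + 1)
  have hZ : IsCompact (insert 0 (Set.range z)) :=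
    tendsto_one_div_add_atTop_nhds_zero_nat.isCompact_insert_range
  have hsub : closure (Set.range fun q : S × ℕ => u q.1 * z q.2) ⊆
      Set.image2 (· * ·) (closure (Set.range u)) (insert 0 (Set.range z)) := by
    refine closure_minimal ?_
      (hb.isCompact_closure.mul hZ).isClosed
    rintro _ ⟨⟨p, k⟩, rfl⟩
    exact ⟨u p, subset_closure ⟨p, rfl⟩, z k, Or.inr ⟨k, rfl⟩, rfl⟩
  have hcount := (hc.image2 ((Set.countable_range z).insert 0) (· * ·)).mono hsub
  have hinf : (closure (Set.range fun q : S × ℕ => u q.1 * z q.2)).Infinite := by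
    -- Already the multiples `u s / (k + 1)` of the single nonzero value `u s` are distinct.
    refine (Set.infinite_range_of_injective (f := fun k : ℕ => u s * z k) ?_).mono ?_
    · intro k l hkl
      have := mul_left_cancel₀ hs hkl
      simpa [z] using this
    · rintro _ ⟨k, rfl⟩
      exact subset_closure ⟨(s, k), rfl⟩
  have := hcount.to_subtype
  have := hinf.to_subtype
  exact Cardinal.mk_eq_aleph0 _

/-- The closure contains `u s` times each point of `[0, 1]`. -/
theorem mk_closure_range_mul_clamp {S : Type} {u : S → ℝ} {s : S} (hs : u s ≠ 0) :
    Cardinal.mk (closure (Set.range fun q : S × ℚ => u q.1 * max 0 (min 1 (q.2 : ℝ)))) =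
      Cardinal.continuum := by
  refine le_antisymm ((Cardinal.mk_set_le _).trans_eq Cardinal.mk_real) ?_
  let h : ℝ → ℝ := fun r => u s * max 0 (min 1 r)
  have hh : Continuous h := by fun_prop
  have hmem : ∀ r, h r ∈ closure (Set.range fun q : S × ℚ => u q.1 * max 0 (min 1 (q.2 : ℝ))) := by
    intro r
    refine closure_mono ?_
      (hh.range_subset_closure_image_dense Rat.denseRange_cast (Set.mem_range_self r))
    rintro _ ⟨_, ⟨q, rfl⟩, rfl⟩
    exact ⟨(s, q), rfl⟩
  rw [← Cardinal.mk_Icc_real zero_lt_one]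
  refine Cardinal.mk_le_of_injective (f := fun r : Set.Icc (0 : ℝ) 1 => ⟨h r, hmem r⟩) ?_
  rintro ⟨r, hr⟩ ⟨r', hr'⟩ hrr
  have := mul_left_cancel₀ hs (congrArg Subtype.val hrr)
  simpa [hr.1, hr.2, hr'.1, hr'.2] using this

theorem lp.isBounded_range {S : Type*} (x : lp (fun _ : S => ℝ) ∞) :
    Bornology.IsBounded (Set.range x) :=
  isBounded_iff_forall_norm_le.2 ⟨‖x‖, Set.forall_mem_range.2 fun p =>
    lp.norm_apply_le_norm ENNReal.top_ne_zero x p⟩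

theorem lp.exists_apply_ne_zero {S : Type*} {x : lp (fun _ : S => ℝ) ∞} (hx : x ≠ 0) :
    ∃ s, x s ≠ 0 := by
  by_contra! h
  exact hx (lp.ext (funext h))

theorem mainTheorem1 (I : Set (Set ℕ)) (hI : IsIdealOnNat I) :
    (HasBaireProperty I →
      ContainsClosedSubspaceOfDensityContinuum (clusterCardSet I Cardinal.aleph0)) ∧
    (HasHereditaryBaireProperty I →
      ContainsClosedSubspaceOfDensityContinuum (clusterCardSet I Cardinal.continuum)) := by
  constructor
  · intro hB
    obtain ⟨f, hf⟩ := hI.exists_forall_fiber_notMem hB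
    refine containsClosedSubspace_of_card_closure_range hI hf (fun k : ℕ => 1 / ((k : ℝ) + 1))
      (fun k => ?_) 0 (by simp) branchSpace (Submodule.isClosed_topologicalClosure _)
      branchIndicator (fun α => Submodule.le_topologicalClosure _ (Submodule.subset_span ⟨α, rfl⟩))
      pairwise_one_le_dist_branchIndicator _ fun x hx hx0 => ?_
    · rw [abs_of_nonneg (by positivity)]
      exact div_le_one_of_le₀ (by simp) (by positivity)
    · obtain ⟨p, hp⟩ := lp.exists_apply_ne_zero hx0
      exact mk_closure_range_mul_one_div (lp.isBounded_range x)
        (countable_closure_range_of_mem_branchSpace hx) hp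
  · -- The clamped rationals are a countable family which is dense in `[0, 1]` and contains `1`.
    intro hB
    obtain ⟨f, hf⟩ := hI.exists_forall_fiber_notMem (hB.hasBaireProperty hI)
    refine containsClosedSubspace_of_card_closure_range hI hf
      (fun q : ℚ => max 0 (min 1 (q : ℝ))) (fun q => ?_) 1 (by simp) ⊤ isClosed_univ
      branchIndicator (fun α => Submodule.mem_top)
      pairwise_one_le_dist_branchIndicator _ fun x _ hx0 => ?_
    · rw [abs_of_nonneg (le_max_left _ _)]
      exact max_le zero_le_one (min_le_left _ _)
    · obtain ⟨p, hp⟩ := lp.exists_apply_ne_zero hx0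
      exact mk_closure_range_mul_clamp hp
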